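/- Represent a permutation $\alpha$ of $\{1,\dots,n\}$ ($n\ge 0$) by its sequence of values $(\alpha_1,\dots,\alpha_n)$. Its shape $\mathrm{sh}(\alpha)$ is the partition of $n$ whose parts are the row lengths of the Young tableau obtained by the Robinson--Schensted(--Knuth) algorithm, i.e. by row-inserting $\alpha_1,\dots,\alpha_n$ successively into the empty tableau. Partitions $\lambda=(\lambda_1\ge\lambda_2\ge\cdots)$ are extended by trailing zeros; $(\lambda+\mu)_i=\lambda_i+\mu_i$, the conjugate $\lambda^*$ is given by $\lambda^*_i=|\{j:\lambda_j\ge i\}|$, and $\lambda+^*\mu=(\lambda^*+\mu^*)^*$. For permutations $\alpha$ of length $n$ and $\beta$ of length $k$ put $$\alpha\oplus\beta=(\alpha_1,\dots,\alpha_n,\,n+\beta_1,\dots,n+\beta_k),\qquad \alpha\ominus\beta=(k+\alpha_1,\dots,k+\alpha_n,\,\beta_1,\dots,\beta_k).$$ **Proposition.** For all permutations $\alpha$ and $\beta$, $$\mathrm{sh}(\alpha\oplus\beta)=\mathrm{sh}(\alpha)+\mathrm{sh}(\beta)\qquad\text{and}\qquad \mathrm{sh}(\alpha\ominus\beta)=\mathrm{sh}(\alpha)+^*\mathrm{sh}(\beta).$$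 -/

import Mathlib

namespace YoungClass

/-- Row insertion of `x` into a row: `x` replaces (bumps) the first entry that is larger than `x`,
and is appended to the row if there is no such entry. The result is the new row, together with the
bumped entry, if any. -/
def rowInsert (x : ℕ) : List ℕ → List ℕ × Option ℕ
  | [] => ([x], none)
  | a :: as =>
    if x < a then (x :: as, some a) else (a :: (rowInsert x as).1, (rowInsert x as).2)

/-- Insertion of `x` into a tableau (the list of its rows, from top to bottom): `x` is inserted into
the first row, the bumped entry (if any) into the second row, and so on. -/
def tableauInsert : List (List ℕ) → ℕ → List (List ℕ)
  | [], x => [[x]]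
  | r :: rs, x =>
    match rowInsert x r with
    | (r', none) => r' :: rs
    | (r', some y) => r' :: tableauInsert rs y

/-- The insertion tableau of a word, obtained by inserting its letters from left to right, starting
from the empty tableau. -/
def insertionTableau (w : List ℕ) : List (List ℕ) :=
  w.foldl tableauInsert []

/-- `Above r s`: the row `s` can stand directly below the row `r`, i.e. it is not longer than `r`
and each of its entries is larger than the entry of `r` directly above it. -/
def Above : List ℕ → List ℕ → Prop
  | _, [] => True
  | [], _ :: _ => False
  | a :: as, b :: bs => a < b ∧ Above as bs

theorem Above.length_le : ∀ {r s : List ℕ}, Above r s → s.length ≤ r.length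
  | _, [], _ => Nat.zero_le _
  | [], _ :: _, h => h.elim
  | _ :: _, _ :: _, h => Nat.succ_le_succ (Above.length_le h.2)

theorem lt_of_bumped {x y : ℕ} : ∀ {r : List ℕ}, (rowInsert x r).2 = some y → x < y
  | [], h => by simp [rowInsert] at h
  | a :: as, h => by
    by_cases hx : x < a
    · simp only [rowInsert, hx, if_true, Option.some.injEq] at h
      omega
    · simp only [rowInsert, hx, if_false] at h
      exact lt_of_bumped h

theorem Above.rowInsert_left (x : ℕ) :
    ∀ {r s : List ℕ}, Above r s → Above (rowInsert x r).1 s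
  | _, [], _ => by simp [Above]
  | [], _ :: _, h => h.elim
  | a :: as, b :: bs, h => by
    by_cases hx : x < a
    · simp only [rowInsert, hx, if_true]
      exact ⟨hx.trans h.1, h.2⟩
    · simp only [rowInsert, hx, if_false]
      exact ⟨h.1, h.2.rowInsert_left x⟩

theorem Above.rowInsert_bumped {x y : ℕ} :
    ∀ {r s : List ℕ}, Above r s → (rowInsert x r).2 = some y →
      Above (rowInsert x r).1 (rowInsert y s).1
  | [], _, _, hy => by simp [rowInsert] at hy
  | a :: as, s, h, hy => by
    have hxy := lt_of_bumped hy
    by_cases hx : x < a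
    · simp only [rowInsert, hx, if_true, Option.some.injEq] at hy ⊢
      subst hy
      cases s with
      | nil => exact ⟨hx, by simp [Above]⟩
      | cons b bs =>
        simp only [rowInsert, h.1, if_true]
        exact ⟨hx, h.2⟩
    · simp only [rowInsert, hx, if_false] at hy ⊢
      cases s with
      | nil => exact ⟨by omega, by simp [Above]⟩
      | cons b bs =>
        by_cases hb : y < b
        · simp only [rowInsert, hb, if_true]
          exact ⟨by omega, h.2.rowInsert_left x⟩
        · simp only [rowInsert, hb, if_false]
          exact ⟨h.1, h.2.rowInsert_bumped hy⟩

theorem head_tableauInsert (T : List (List ℕ)) (x : ℕ) :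
    ∃ T', tableauInsert T x = (rowInsert x (T.headD [])).1 :: T' := by
  cases T with
  | nil => exact ⟨[], rfl⟩
  | cons r rs =>
    rcases h : rowInsert x r with ⟨r', _ | y⟩ <;> simp [tableauInsert, h]

theorem isChain_tableauInsert :
    ∀ (T : List (List ℕ)) (x : ℕ), T.IsChain Above → (tableauInsert T x).IsChain Above
  | [], x, _ => by simp [tableauInsert]
  | r :: rs, x, hT => by
    rcases h : rowInsert x r with ⟨r', _ | y⟩
    · simp only [tableauInsert, h]
      cases rs with
      | nil => simp
      | cons s rs =>
        rw [List.isChain_cons_cons] at hT ⊢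
        have := hT.1.rowInsert_left x
        rw [h] at this
        exact ⟨this, hT.2⟩
    · simp only [tableauInsert, h]
      have ih := isChain_tableauInsert rs y hT.tail
      obtain ⟨T', hT'⟩ := head_tableauInsert rs y
      rw [hT'] at ih ⊢
      rw [List.isChain_cons_cons]
      refine ⟨?_, ih⟩
      have hab : Above r (rs.headD []) := by
        cases rs with
        | nil => simp [Above]
        | cons s rs => exact (List.isChain_cons_cons.1 hT).1
      have := hab.rowInsert_bumped (x := x) (y := y) (by rw [h])
      rwa [h] at this

theorem isChain_insertionTableau (w : List ℕ) : (insertionTableau w).IsChain Above := by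
  suffices H : ∀ (w : List ℕ) (T : List (List ℕ)), T.IsChain Above →
      (w.foldl tableauInsert T).IsChain Above from H w [] (by simp)
  intro w
  induction w with
  | nil => exact fun T hT => hT
  | cons x w ih => exact fun T hT => ih _ (isChain_tableauInsert T x hT)

/-- The row lengths of an insertion tableau are weakly decreasing. -/
theorem sortedGE_insertionTableau (w : List ℕ) :
    ((insertionTableau w).map List.length).SortedGE := by
  refine List.Pairwise.sortedGE (List.isChain_iff_pairwise.1 ?_)
  rw [List.isChain_map]
  exact (isChain_insertionTableau w).imp fun _ _ h => h.length_le

/-- The shape `sh π` of a permutation `π` of `{0, …, n - 1}`: the partition (as a Young diagram)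
whose parts are the row lengths of the insertion tableau of `π 0, π 1, …, π (n - 1)`. -/
def shape {n : ℕ} (π : Equiv.Perm (Fin n)) : YoungDiagram :=
  YoungDiagram.ofRowLens
    ((insertionTableau (List.ofFn fun i => (π i : ℕ))).map List.length)
    (sortedGE_insertionTableau _)

/-- The sum of two partitions: row `i` of `partSum μ ν` has length `μ.rowLen i + ν.rowLen i`. -/
def partSum (μ ν : YoungDiagram) : YoungDiagram where
  cells := (Finset.range (max (μ.colLen 0) (ν.colLen 0)) ×ˢ
    Finset.range (μ.rowLen 0 + ν.rowLen 0)).filter fun c => c.2 < μ.rowLen c.1 + ν.rowLen c.1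
  isLowerSet := by
    rintro ⟨i, j⟩ ⟨i', j'⟩ ⟨hi, hj⟩ h
    simp only [Finset.coe_filter, Finset.mem_product, Finset.mem_range, Set.mem_ofPred_eq] at h ⊢
    simp only at hi hj
    have h1 := μ.rowLen_anti i' i hi
    have h2 := ν.rowLen_anti i' i hi
    omega

theorem rowLen_partSum (μ ν : YoungDiagram) (i : ℕ) :
    (partSum μ ν).rowLen i = μ.rowLen i + ν.rowLen i := by
  refine eq_of_forall_lt_iff fun j => ?_
  rw [← YoungDiagram.mem_iff_lt_rowLen, ← YoungDiagram.mem_cells]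
  simp only [partSum, Finset.mem_filter, Finset.mem_product, Finset.mem_range]
  refine ⟨fun h => h.2, fun h => ⟨⟨?_, ?_⟩, h⟩⟩
  · rw [lt_max_iff, ← YoungDiagram.mem_iff_lt_colLen, ← YoungDiagram.mem_iff_lt_colLen,
      YoungDiagram.mem_iff_lt_rowLen, YoungDiagram.mem_iff_lt_rowLen]
    omega
  · have h1 := μ.rowLen_anti 0 i (Nat.zero_le _)
    have h2 := ν.rowLen_anti 0 i (Nat.zero_le _)
    omega

/-- The conjugate sum of two partitions, `(μ* + ν*)*`. -/
def conjSum (μ ν : YoungDiagram) : YoungDiagram :=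
  (partSum μ.transpose ν.transpose).transpose

/-- The direct sum `α ⊕ β = (α₁, …, αₙ, n + β₁, …, n + βₖ)`. -/
def directSum {n k : ℕ} (α : Equiv.Perm (Fin n)) (β : Equiv.Perm (Fin k)) :
    Equiv.Perm (Fin (n + k)) :=
  finSumFinEquiv.symm.trans ((Equiv.sumCongr α β).trans finSumFinEquiv)

/-- The skew sum `α ⊖ β = (k + α₁, …, k + αₙ, β₁, …, βₖ)`. -/
def skewSum {n k : ℕ} (α : Equiv.Perm (Fin n)) (β : Equiv.Perm (Fin k)) :
    Equiv.Perm (Fin (n + k)) :=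
  finSumFinEquiv.symm.trans ((Equiv.sumCongr α β).trans
    ((Equiv.sumComm (Fin n) (Fin k)).trans (finSumFinEquiv.trans (finCongr (Nat.add_comm k n)))))

theorem directSum_castAdd {n k : ℕ} (α : Equiv.Perm (Fin n)) (β : Equiv.Perm (Fin k)) (i : Fin n) :
    (directSum α β (Fin.castAdd k i) : ℕ) = α i := by
  simp [directSum]

theorem directSum_natAdd {n k : ℕ} (α : Equiv.Perm (Fin n)) (β : Equiv.Perm (Fin k)) (j : Fin k) :
    (directSum α β (Fin.natAdd n j) : ℕ) = n + β j := by
  simp [directSum]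

theorem skewSum_castAdd {n k : ℕ} (α : Equiv.Perm (Fin n)) (β : Equiv.Perm (Fin k)) (i : Fin n) :
    (skewSum α β (Fin.castAdd k i) : ℕ) = k + α i := by
  simp [skewSum, Nat.add_comm]

theorem skewSum_natAdd {n k : ℕ} (α : Equiv.Perm (Fin n)) (β : Equiv.Perm (Fin k)) (j : Fin k) :
    (skewSum α β (Fin.natAdd n j) : ℕ) = β j := by
  simp [skewSum]

end YoungClass

namespace YoungClass

/-! ### Row and tableau insertion -/

/-! Insertion depends only on comparisons between letters, so shifting a word shifts its tableau and
keeps the shape. It remains to follow the letters of the second word as they enter the tableau `A`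
of the first.

Direct sum: the new letters are at least as large as all entries of `A`. In every row such a letter
passes over the part coming from `A` and can bump only another new letter, so the new letters form
their own tableau to the right of `A` (`insertionTableau_append_of_le`). Row lengths add.

Skew sum: the new letters are smaller than all entries of `A`. Let `S` be the tableau they form on
their own. Each column of the result is a column of `S` on top of the corresponding column of `A`
(`insertionTableau_append_of_lt`). Indeed, a new letter bumps new letters as it does in `S`, until
one is appended to a row of `S`, say in column `c`. There it displaces the topmost remaining entry
of column `c` of `A`, if any, and this starts a chain of bumps that moves the rest of that column
down by one and touches no other column (`tableauInsert_stack_raiseFrom`). Column lengths add. -/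

theorem tableauInsert_cons (r : List ℕ) (rs : List (List ℕ)) (x : ℕ) :
    tableauInsert (r :: rs) x =
      (rowInsert x r).1 :: (rowInsert x r).2.elim rs (tableauInsert rs) := by
  rcases h : rowInsert x r with ⟨r', _ | y⟩ <;> simp [tableauInsert, h]

theorem rowInsert_append_of_le {x : ℕ} {u : List ℕ} (h : ∀ a ∈ u, a ≤ x) (v : List ℕ) :
    rowInsert x (u ++ v) = (u ++ (rowInsert x v).1, (rowInsert x v).2) := by
  induction u with
  | nil => rfl
  | cons a u ih =>
    have ha : ¬ x < a := by simpa using h a (by simp)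
    simp [rowInsert, ha, ih fun b hb => h b (by simp [hb])]

theorem rowInsert_append_of_bumped {x y : ℕ} {u : List ℕ} (h : (rowInsert x u).2 = some y)
    (v : List ℕ) : rowInsert x (u ++ v) = ((rowInsert x u).1 ++ v, some y) := by
  induction u with
  | nil => simp [rowInsert] at h
  | cons a u ih =>
    by_cases ha : x < a
    · simp_all [rowInsert]
    · simp only [rowInsert, ha, if_false] at h
      simp [rowInsert, ha, ih h]

theorem rowInsert_of_not_bumped {x : ℕ} {u : List ℕ} (h : (rowInsert x u).2 = none) :
    (∀ a ∈ u, a ≤ x) ∧ (rowInsert x u).1 = u ++ [x] := by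
  induction u with
  | nil => simp [rowInsert]
  | cons a u ih =>
    by_cases ha : x < a
    · simp [rowInsert, ha] at h
    · simp only [rowInsert, ha, if_false] at h ⊢
      simpa [ih h] using ⟨not_lt.1 ha, (ih h).1⟩

theorem length_rowInsert_of_bumped {x y : ℕ} {u : List ℕ} (h : (rowInsert x u).2 = some y) :
    (rowInsert x u).1.length = u.length := by
  induction u with
  | nil => simp [rowInsert] at h
  | cons a u ih =>
    by_cases ha : x < a
    · simp [rowInsert, ha]
    · simp only [rowInsert, ha, if_false] at h
      simp [rowInsert, ha, ih h]

theorem mem_of_bumped {x y : ℕ} {u : List ℕ} (h : (rowInsert x u).2 = some y) : y ∈ u := by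
  induction u with
  | nil => simp [rowInsert] at h
  | cons a u ih =>
    by_cases ha : x < a
    · simp_all [rowInsert]
    · simp only [rowInsert, ha, if_false] at h
      simp [ih h]

theorem mem_rowInsert {x a : ℕ} {u : List ℕ} (h : a ∈ (rowInsert x u).1) : a = x ∨ a ∈ u := by
  induction u with
  | nil => simpa [rowInsert] using h
  | cons b u ih =>
    by_cases hb : x < b
    · simp only [rowInsert, hb, if_true, List.mem_cons] at h ⊢
      tauto
    · simp only [rowInsert, hb, if_false, List.mem_cons] at h ⊢
      tauto

theorem rowInsert_ne_nil (x : ℕ) (u : List ℕ) : (rowInsert x u).1 ≠ [] := by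
  cases u with
  | nil => simp [rowInsert]
  | cons a u => by_cases h : x < a <;> simp [rowInsert, h]

theorem pairwise_rowInsert (x : ℕ) {u : List ℕ} (h : u.Pairwise (· ≤ ·)) :
    (rowInsert x u).1.Pairwise (· ≤ ·) := by
  induction u with
  | nil => simp [rowInsert]
  | cons a u ih =>
    rw [List.pairwise_cons] at h
    by_cases ha : x < a
    · simp only [rowInsert, ha, if_true, List.pairwise_cons]
      exact ⟨fun b hb => ha.le.trans (h.1 b hb), h.2⟩
    · simp only [rowInsert, ha, if_false, List.pairwise_cons]
      refine ⟨fun b hb => ?_, ih h.2⟩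
      rcases mem_rowInsert hb with rfl | hb
      · exact not_lt.1 ha
      · exact h.1 b hb

theorem mem_of_mem_tableauInsert {T : List (List ℕ)} {x a : ℕ} {r : List ℕ}
    (hr : r ∈ tableauInsert T x) (ha : a ∈ r) : a = x ∨ ∃ s ∈ T, a ∈ s := by
  induction T generalizing x with
  | nil => simp_all [tableauInsert]
  | cons s T ih =>
    rw [tableauInsert_cons, List.mem_cons] at hr
    rcases hr with rfl | hr
    · exact (mem_rowInsert ha).imp_right fun h => ⟨s, by simp, h⟩
    · rcases h : (rowInsert x s).2 with _ | y
      · rw [h] at hr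
        exact Or.inr ⟨r, List.mem_cons_of_mem _ hr, ha⟩
      · rw [h] at hr
        rcases ih hr with rfl | ⟨t, ht, hat⟩
        · exact Or.inr ⟨s, by simp, mem_of_bumped h⟩
        · exact Or.inr ⟨t, List.mem_cons_of_mem _ ht, hat⟩

theorem forall_row_tableauInsert {T : List (List ℕ)}
    (hT : ∀ r ∈ T, r.Pairwise (· ≤ ·) ∧ r ≠ []) (x : ℕ) :
    ∀ r ∈ tableauInsert T x, r.Pairwise (· ≤ ·) ∧ r ≠ [] := by
  induction T generalizing x with
  | nil => simp [tableauInsert]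
  | cons s T ih =>
    rw [List.forall_mem_cons] at hT
    rw [tableauInsert_cons, List.forall_mem_cons]
    refine ⟨⟨pairwise_rowInsert x hT.1.1, rowInsert_ne_nil x s⟩, ?_⟩
    rcases (rowInsert x s).2 with _ | y
    · exact hT.2
    · exact ih hT.2 y

theorem insertionTableau_append_singleton (w : List ℕ) (x : ℕ) :
    insertionTableau (w ++ [x]) = tableauInsert (insertionTableau w) x := by
  simp [insertionTableau]

theorem forall_row_insertionTableau (w : List ℕ) :
    ∀ r ∈ insertionTableau w, r.Pairwise (· ≤ ·) ∧ r ≠ [] := by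
  induction w using List.reverseRecOn with
  | nil => simp [insertionTableau]
  | append_singleton w x ih =>
    rw [insertionTableau_append_singleton]
    exact forall_row_tableauInsert ih x

theorem mem_of_mem_insertionTableau {w r : List ℕ} {a : ℕ} (hr : r ∈ insertionTableau w)
    (ha : a ∈ r) : a ∈ w := by
  induction w using List.reverseRecOn generalizing r with
  | nil => simp [insertionTableau] at hr
  | append_singleton w x ih =>
    rw [insertionTableau_append_singleton] at hr
    rcases mem_of_mem_tableauInsert hr ha with rfl | ⟨s, hs, has⟩
    · simp
    · simp [ih hs has]

theorem rowInsert_map_add (m x : ℕ) (u : List ℕ) :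
    rowInsert (m + x) (u.map (m + ·)) =
      ((rowInsert x u).1.map (m + ·), (rowInsert x u).2.map (m + ·)) := by
  induction u with
  | nil => rfl
  | cons a u ih => by_cases h : x < a <;> simp [rowInsert, h, ih]

theorem tableauInsert_map_add (m x : ℕ) (T : List (List ℕ)) :
    tableauInsert (T.map (List.map (m + ·))) (m + x) =
      (tableauInsert T x).map (List.map (m + ·)) := by
  induction T generalizing x with
  | nil => rfl
  | cons r T ih =>
    rw [List.map_cons, tableauInsert_cons, tableauInsert_cons, rowInsert_map_add, List.map_cons]
    rcases (rowInsert x r).2 with _ | y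
    · rfl
    · simp [ih]

theorem insertionTableau_map_add (m : ℕ) (w : List ℕ) :
    insertionTableau (w.map (m + ·)) = (insertionTableau w).map (List.map (m + ·)) := by
  induction w using List.reverseRecOn with
  | nil => rfl
  | append_singleton w x ih =>
    rw [List.map_append, List.map_singleton, insertionTableau_append_singleton, ih,
      tableauInsert_map_add, insertionTableau_append_singleton]

/-! ### Juxtaposition of tableaux -/

/-- The tableau whose rows are the rows of the first tableau followed by those of the second. -/
def juxtapose : List (List ℕ) → List (List ℕ) → List (List ℕ)
  | [], S => S
  | r :: R, [] => r :: R
  | r :: R, s :: S => (r ++ s) :: juxtapose R S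

theorem juxtapose_nil (R : List (List ℕ)) : juxtapose R [] = R := by
  cases R <;> rfl

/-- Weak bounds suffice because a letter bumps only strictly larger ones. A bumped letter comes from
`S`, so it again satisfies `m ≤ y` and the argument repeats one row lower. -/
theorem tableauInsert_juxtapose {m : ℕ} {R S : List (List ℕ)} (hR : ∀ r ∈ R, ∀ a ∈ r, a ≤ m)
    (hS : ∀ s ∈ S, ∀ a ∈ s, m ≤ a) {x : ℕ} (hx : m ≤ x) :
    tableauInsert (juxtapose R S) x = juxtapose R (tableauInsert S x) := by
  induction R generalizing S x with
  | nil => rfl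
  | cons r R ih =>
    rw [List.forall_mem_cons] at hR
    have hr : ∀ a ∈ r, a ≤ x := fun a ha => (hR.1 a ha).trans hx
    cases S with
    | nil =>
      have := rowInsert_append_of_le hr []
      rw [List.append_nil] at this
      rw [juxtapose_nil, tableauInsert_cons, this]
      simp [tableauInsert, rowInsert, juxtapose, juxtapose_nil]
    | cons s S =>
      rw [List.forall_mem_cons] at hS
      rw [juxtapose, tableauInsert_cons, tableauInsert_cons, rowInsert_append_of_le hr, juxtapose]
      congr 1
      rcases h : (rowInsert x s).2 with _ | y
      · rfl
      · exact ih hR.2 hS.2 (hS.1 y (mem_of_bumped h))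

theorem insertionTableau_append_of_le {m : ℕ} {u v : List ℕ} (hu : ∀ a ∈ u, a ≤ m)
    (hv : ∀ a ∈ v, m ≤ a) :
    insertionTableau (u ++ v) = juxtapose (insertionTableau u) (insertionTableau v) := by
  induction v using List.reverseRecOn with
  | nil => simp [insertionTableau, juxtapose_nil]
  | append_singleton v x ih =>
    rw [← List.append_assoc, insertionTableau_append_singleton,
      ih fun a ha => hv a (by simp [ha]), insertionTableau_append_singleton]
    exact tableauInsert_juxtapose (fun r hr a ha => hu a (mem_of_mem_insertionTableau hr ha))
      (fun s hs a ha => hv a (by simp [mem_of_mem_insertionTableau hs ha])) (hv x (by simp))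

theorem length_getD_juxtapose (R S : List (List ℕ)) (i : ℕ) :
    ((juxtapose R S).getD i []).length = (R.getD i []).length + (S.getD i []).length := by
  induction R generalizing S i with
  | nil => simp [juxtapose]
  | cons r R ih =>
    cases S with
    | nil => simp [juxtapose]
    | cons s S =>
      cases i with
      | zero => simp [juxtapose]
      | succ i => simpa [juxtapose] using ih S i

/-! ### Entries of a tableau -/

/-- The entry in row `i` and column `j`, if there is one. -/
def entry (T : List (List ℕ)) (i j : ℕ) : Option ℕ := (T.getD i [])[j]?

theorem entry_cons_zero (r : List ℕ) (T : List (List ℕ)) (j : ℕ) :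
    entry (r :: T) 0 j = r[j]? := rfl

theorem entry_cons_succ (r : List ℕ) (T : List (List ℕ)) (i j : ℕ) :
    entry (r :: T) (i + 1) j = entry T i j := rfl

theorem ext_entry {T U : List (List ℕ)} (hl : T.length = U.length)
    (h : ∀ i j, entry T i j = entry U i j) : T = U := by
  refine List.ext_getElem hl fun i h1 h2 => List.ext_getElem? fun j => ?_
  simpa [entry, h1, h2] using h i j

/-- The nonempty rows are weakly increasing and form a Young diagram, in which the columns are
strictly increasing. -/
structure IsSemistandard (T : List (List ℕ)) : Prop where
  isSome : ∀ i < T.length, (entry T i 0).isSome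
  le : ∀ i j j' b, j ≤ j' → entry T i j' = some b → ∃ a, entry T i j = some a ∧ a ≤ b
  lt : ∀ i i' j b, i < i' → entry T i' j = some b → ∃ a, entry T i j = some a ∧ a < b

theorem Above.exists_getElem? {r s : List ℕ} (h : Above r s) {j b : ℕ} (hb : s[j]? = some b) :
    ∃ a, r[j]? = some a ∧ a < b := by
  induction s generalizing r j with
  | nil => simp at hb
  | cons c s ih =>
    cases r with
    | nil => exact h.elim
    | cons a r =>
      cases j with
      | zero => simp_all [Above]
      | succ j => simpa using ih h.2 (by simpa using hb)

theorem isSemistandard_of_isChain {T : List (List ℕ)} (hT : T.IsChain Above)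
    (hr : ∀ r ∈ T, r.Pairwise (· ≤ ·) ∧ r ≠ []) : IsSemistandard T where
  isSome i hi := by
    have := (hr T[i] (by simp)).2
    simpa [entry, hi, List.length_pos_iff] using this
  le i j j' b hj hb := by
    by_cases hi : i < T.length
    · have h := (hr T[i] (by simp)).1
      simp only [entry, List.getD_eq_getElem _ _ hi] at hb ⊢
      obtain ⟨hj', rfl⟩ := List.getElem?_eq_some_iff.1 hb
      refine ⟨T[i][j], by simp, ?_⟩
      rcases hj.eq_or_lt with rfl | hlt
      · exact le_rfl
      · exact List.pairwise_iff_getElem.1 h _ _ _ _ hlt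
    · simp [entry, hi] at hb
  lt i i' j b hi hb := by
    obtain ⟨d, rfl⟩ : ∃ d, i' = i + 1 + d := ⟨i' - (i + 1), by omega⟩
    have step : ∀ i b, entry T (i + 1) j = some b → ∃ a, entry T i j = some a ∧ a < b := by
      intro i b hb
      by_cases h : i + 1 < T.length
      · have hab := List.isChain_iff_getElem.1 hT i h
        simp only [entry, List.getD_eq_getElem _ _ h,
          List.getD_eq_getElem _ _ (Nat.lt_of_succ_lt h)] at hb ⊢
        exact hab.exists_getElem? hb
      · simp [entry, h] at hb
    induction d generalizing b with
    | zero => exact step i b hb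
    | succ d ih =>
      obtain ⟨c, hc, hcb⟩ := step _ b hb
      obtain ⟨a, ha, hac⟩ := ih c (by omega) hc
      exact ⟨a, ha, hac.trans hcb⟩

theorem isSemistandard_insertionTableau (w : List ℕ) : IsSemistandard (insertionTableau w) :=
  isSemistandard_of_isChain (isChain_insertionTableau w) (forall_row_insertionTableau w)

theorem IsSemistandard.tail {r : List ℕ} {T : List (List ℕ)} (h : IsSemistandard (r :: T)) :
    IsSemistandard T where
  isSome i hi := h.isSome (i + 1) (by simpa using hi)
  le i := h.le (i + 1)
  lt i i' j b hi hb := h.lt (i + 1) (i' + 1) j b (by omega) hb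

theorem IsSemistandard.length_le {T : List (List ℕ)} (h : IsSemistandard T) (i : ℕ) :
    (T.getD (i + 1) []).length ≤ (T.getD i []).length := by
  by_contra! hlt
  obtain ⟨a, ha, -⟩ := h.lt i (i + 1) _ _ (by omega) (List.getElem?_eq_getElem hlt)
  obtain ⟨h', -⟩ := List.getElem?_eq_some_iff.1 ha
  exact h'.false

/-! ### Stacking the columns of tableaux -/

/-- Remove the top entry of each column `j ≥ c` and move the rest of the column up. -/
def raiseFrom (c : ℕ) : List (List ℕ) → List (List ℕ)
  | [] => []
  | r :: T => (r.take c ++ (T.headD []).drop c) :: raiseFrom c T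

theorem length_raiseFrom (c : ℕ) (T : List (List ℕ)) : (raiseFrom c T).length = T.length := by
  induction T with
  | nil => rfl
  | cons r T ih => simp [raiseFrom, ih]

/-- Weakly decreasing row lengths are essential: if a row is shorter than `c`, the row below has
nothing left after `drop c`, so the concatenation never moves an entry to another column. -/
theorem entry_raiseFrom {T : List (List ℕ)} (hT : IsSemistandard T) (c i j : ℕ) :
    entry (raiseFrom c T) i j = if j < c then entry T i j else entry T (i + 1) j := by
  induction T generalizing i with
  | nil => simp [raiseFrom, entry]
  | cons r T ih =>
    cases i with
    | succ i => exact ih hT.tail i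
    | zero =>
      have h0 := hT.length_le 0
      have h1 : T.getD 0 [] = T.headD [] := by cases T <;> rfl
      rw [raiseFrom, entry_cons_zero, entry_cons_zero, entry_cons_succ, entry, h1]
      simp only [List.getD_cons_succ, h1, List.getD_cons_zero] at h0
      grind

/-- With `0 < c` the first column stays in place, so no row becomes empty although the number of
rows is kept. -/
theorem IsSemistandard.raiseFrom {T : List (List ℕ)} (hT : IsSemistandard T) {c : ℕ}
    (hc : 0 < c) : IsSemistandard (raiseFrom c T) where
  isSome i hi := by
    rw [entry_raiseFrom hT, if_pos hc]
    exact hT.isSome i (by rwa [length_raiseFrom] at hi)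
  le i j j' b hj hb := by
    rw [entry_raiseFrom hT] at hb ⊢
    split_ifs at hb ⊢ with h1 h2
    · exact hT.le _ _ _ _ hj hb
    -- Here `j < c ≤ j'`: the right entry was raised from row `i + 1`, the left one was not. They
    -- are compared through the entry at `(i + 1, j)`.
    · obtain ⟨a, ha, hab⟩ := hT.le _ _ _ _ hj hb
      obtain ⟨a', ha', haa⟩ := hT.lt i _ _ _ (Nat.lt_succ_self i) ha
      exact ⟨a', ha', (haa.trans_le hab).le⟩
    · omega
    · exact hT.le _ _ _ _ hj hb
  lt i i' j b hi hb := by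
    rw [entry_raiseFrom hT] at hb ⊢
    split_ifs at hb ⊢ with h1
    · exact hT.lt _ _ _ _ hi hb
    · exact hT.lt _ _ _ _ (by omega) hb

theorem raiseFrom_comm {T : List (List ℕ)} (hT : IsSemistandard T) {c d : ℕ} (hc : 0 < c)
    (hd : 0 < d) : raiseFrom d (raiseFrom c T) = raiseFrom c (raiseFrom d T) := by
  refine ext_entry (by simp [length_raiseFrom]) fun i j => ?_
  rw [entry_raiseFrom (hT.raiseFrom hc), entry_raiseFrom (hT.raiseFrom hd)]
  simp only [entry_raiseFrom hT]
  split_ifs <;> rfl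

/-- Column `c` is empty, so raising it has no effect. This covers the end of a bumping chain, where
no entry is left to push down. -/
theorem raiseFrom_succ_of_entry_eq_none {T : List (List ℕ)} (hT : IsSemistandard T) {c : ℕ}
    (h : entry T 0 c = none) : raiseFrom (c + 1) T = raiseFrom c T := by
  refine ext_entry (by simp [length_raiseFrom]) fun i j => ?_
  have hn : ∀ i, entry T i c = none := by
    intro i
    by_contra hi
    obtain ⟨b, hb⟩ := Option.ne_none_iff_exists'.1 hi
    rcases Nat.eq_zero_or_pos i with rfl | hi
    · simp_all
    · obtain ⟨a, ha, -⟩ := hT.lt 0 i c b hi hb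
      simp_all
  rw [entry_raiseFrom hT, entry_raiseFrom hT]
  rcases lt_trichotomy j c with h | rfl | h
  · rw [if_pos h, if_pos (by omega)]
  · simp [hn]
  · rw [if_neg (by omega), if_neg (by omega)]

theorem mem_of_mem_raiseFrom {c a : ℕ} {T : List (List ℕ)} {r : List ℕ} (hr : r ∈ raiseFrom c T)
    (ha : a ∈ r) : ∃ s ∈ T, a ∈ s := by
  induction T with
  | nil => simp [raiseFrom] at hr
  | cons s T ih =>
    rw [raiseFrom, List.mem_cons] at hr
    rcases hr with rfl | hr
    · rcases List.mem_append.1 ha with ha | ha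
      · exact ⟨s, by simp, List.mem_of_mem_take ha⟩
      · cases T with
        | nil => simp at ha
        | cons t T => exact ⟨t, by simp, List.mem_of_mem_drop ha⟩
    · obtain ⟨t, ht, hat⟩ := ih hr
      exact ⟨t, List.mem_cons_of_mem _ ht, hat⟩

/-- The tableau whose columns are the columns of the first tableau, each followed by the
corresponding column of the second. -/
def stack : List (List ℕ) → List (List ℕ) → List (List ℕ)
  | [], A => A
  | s :: S, A => (s ++ (A.headD []).drop s.length) :: stack S (raiseFrom s.length A)

/-- Used with `u` of length `c`, where it says that a bump stays in its column: `x` lands in column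
`c` and displaces the entry `v[c]`. -/
theorem rowInsert_append_drop {x c : ℕ} {u v : List ℕ} (hu : ∀ a ∈ u, a ≤ x)
    (hv : ∀ b, v[c]? = some b → x < b) :
    rowInsert x (u ++ v.drop c) = (u ++ x :: v.drop (c + 1), v[c]?) := by
  rw [rowInsert_append_of_le hu]
  by_cases hc : c < v.length
  · rw [List.drop_eq_getElem_cons hc, rowInsert, if_pos (hv _ (List.getElem?_eq_getElem hc)),
      List.getElem?_eq_getElem hc]
  · rw [List.drop_eq_nil_of_le (by omega), List.drop_eq_nil_of_le (by omega),
      List.getElem?_eq_none (by omega)]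
    rfl

theorem headD_getElem? (T : List (List ℕ)) (j : ℕ) : (T.headD [])[j]? = entry T 0 j := by
  cases T <;> rfl

theorem IsSemistandard.forall_mem_take_le {r : List ℕ} {T : List (List ℕ)}
    (h : IsSemistandard (r :: T)) {c z : ℕ} (hz : r[c]? = some z) : ∀ a ∈ r.take c, a ≤ z := by
  intro a ha
  obtain ⟨j, hj, rfl⟩ := List.mem_iff_getElem.1 ha
  have hj' : j < c := by simp at hj; omega
  obtain ⟨b, hb, hbz⟩ := h.le 0 j c z hj'.le hz
  rw [entry_cons_zero] at hb
  obtain ⟨_, rfl⟩ := List.getElem?_eq_some_iff.1 hb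
  simpa using hbz

theorem take_succ_of_getElem? {r : List ℕ} {c z : ℕ} (hz : r[c]? = some z) :
    r.take (c + 1) = r.take c ++ [z] := by
  rw [List.take_add_one, hz, Option.toList_some]

/-- Putting `z` back undoes the raising of column `c` alone: `z` is at least every entry to its left
and smaller than the next entry of its column, so each bump stays in that column. -/
theorem tableauInsert_raiseFrom {A : List (List ℕ)} (hA : IsSemistandard A) {c z : ℕ}
    (hz : entry A 0 c = some z) : tableauInsert (raiseFrom c A) z = raiseFrom (c + 1) A := by
  induction A generalizing z with
  | nil => simp [entry] at hz
  | cons r T ih =>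
    have hlt : ∀ b, (T.headD [])[c]? = some b → z < b := by
      intro b hb
      rw [headD_getElem?] at hb
      obtain ⟨a, ha, hab⟩ := hA.lt 0 1 c b Nat.zero_lt_one hb
      simp_all
    rw [entry_cons_zero] at hz
    rw [raiseFrom, tableauInsert_cons, rowInsert_append_drop (hA.forall_mem_take_le hz) hlt,
      raiseFrom, take_succ_of_getElem? hz, List.append_assoc, List.singleton_append,
      headD_getElem?]
    congr 1
    rcases h : entry T 0 c with _ | y
    · exact (raiseFrom_succ_of_entry_eq_none hA.tail h).symm
    · exact ih hA.tail h

/-- The same chain of bumps, running past the remaining rows of `S`. These have length at most `c`,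
so in column `c` it meets only entries of `A`; the entries of `S` to the left are at most `m ≤ z`.
-/
theorem tableauInsert_stack_raiseFrom {m : ℕ} {S A : List (List ℕ)} (hA : IsSemistandard A)
    (hAm : ∀ r ∈ A, ∀ a ∈ r, m ≤ a) (hS : ∀ s ∈ S, ∀ a ∈ s, a ≤ m) (hne : ∀ s ∈ S, s ≠ [])
    {c z : ℕ} (hc : 0 < c) (hSc : ∀ s ∈ S, s.length ≤ c) (hz : entry A 0 c = some z) :
    tableauInsert (stack S (raiseFrom c A)) z = stack S (raiseFrom (c + 1) A) := by
  induction S generalizing A z with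
  | nil => exact tableauInsert_raiseFrom hA hz
  | cons s S ih =>
    rw [List.forall_mem_cons] at hS hne hSc
    have hd : 0 < s.length := List.length_pos_iff.2 hne.1
    cases A with
    | nil => simp [entry] at hz
    | cons r T =>
      have hlt : ∀ b, (T.headD [])[c]? = some b → z < b := by
        intro b hb
        rw [headD_getElem?] at hb
        obtain ⟨a, ha, hab⟩ := hA.lt 0 1 c b Nat.zero_lt_one hb
        simp_all
      have hr := hz
      rw [entry_cons_zero] at hr
      obtain ⟨hcr, hrz⟩ := List.getElem?_eq_some_iff.1 hr
      have hmz : m ≤ z := hAm r (by simp) z (List.mem_of_getElem? hr)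
      have hle : ∀ a ∈ s ++ (r.take c).drop s.length, a ≤ z := by
        intro a ha
        rcases List.mem_append.1 ha with ha | ha
        · exact (hS.1 a ha).trans hmz
        · exact hA.forall_mem_take_le hr a (List.mem_of_mem_drop ha)
      have h1 : (raiseFrom c (r :: T)).headD [] = r.take c ++ (T.headD []).drop c := rfl
      have h2 : (raiseFrom (c + 1) (r :: T)).headD [] =
        r.take c ++ (z :: (T.headD []).drop (c + 1)) := by
        simp [raiseFrom, take_succ_of_getElem? hr]
      have h3 : s.length ≤ (r.take c).length := by simp; omega
      rw [stack, stack, h1, h2, List.drop_append_of_le_length h3, List.drop_append_of_le_length h3,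
        ← List.append_assoc, ← List.append_assoc, tableauInsert_cons,
        rowInsert_append_drop hle hlt, raiseFrom_comm hA hc hd,
        raiseFrom_comm hA (Nat.succ_pos c) hd, headD_getElem?]
      congr 1
      -- Since `s.length ≤ c`, passing the row `s` uses up the top entry of column `c`; the next one
      -- to be pushed is the entry below it.
      have h4 : entry (raiseFrom s.length (r :: T)) 0 c = entry T 0 c := by
        rw [entry_raiseFrom hA, if_neg (by omega), entry_cons_succ]
      rcases h : entry T 0 c with _ | y
      · rw [raiseFrom_succ_of_entry_eq_none (hA.raiseFrom hd) (h4.trans h)]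
        rfl
      · refine ih (hA.raiseFrom hd) (fun t ht a ha => ?_) hS.2 hne.2 hSc.2 (h4.trans h)
        obtain ⟨u, hu, hau⟩ := mem_of_mem_raiseFrom ht ha
        exact hAm u hu a hau

/-- A letter below the corner entry pushes the whole first column down by one. -/
theorem tableauInsert_eq_stack_singleton {A : List (List ℕ)} (hA : IsSemistandard A) {x : ℕ}
    (hx : ∀ b, entry A 0 0 = some b → x < b) : tableauInsert A x = stack [[x]] A := by
  induction A generalizing x with
  | nil => rfl
  | cons r T ih =>
    cases r with
    | nil => simpa [entry] using hA.isSome 0 (by simp)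
    | cons a r =>
      have hxa : x < a := hx a rfl
      have hT : ∀ b, entry T 0 0 = some b → a < b := by
        intro b hb
        obtain ⟨a', ha', hab⟩ := hA.lt 0 1 0 b Nat.zero_lt_one hb
        simp_all [entry_cons_zero]
      simp [tableauInsert_cons, rowInsert, hxa, ih hA.tail hT, stack, raiseFrom]

theorem tableauInsert_stack {m : ℕ} {S A : List (List ℕ)} (hA : IsSemistandard A)
    (hAm : ∀ r ∈ A, ∀ a ∈ r, m ≤ a) (hS : ∀ s ∈ S, ∀ a ∈ s, a < m) (hne : ∀ s ∈ S, s ≠ [])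
    (hlen : S.Pairwise fun s t => t.length ≤ s.length) {x : ℕ} (hx : x < m) :
    tableauInsert (stack S A) x = stack (tableauInsert S x) A := by
  have hlt : ∀ c b, entry A 0 c = some b → m ≤ b := by
    intro c b hb
    cases A with
    | nil => simp [entry] at hb
    | cons r T => exact hAm r (by simp) b (List.mem_of_getElem? hb)
  induction S generalizing A x with
  | nil => exact tableauInsert_eq_stack_singleton hA fun b hb => hx.trans_le (hlt 0 b hb)
  | cons s S ih =>
    rw [List.forall_mem_cons] at hS hne
    rw [List.pairwise_cons] at hlen
    have hd : 0 < s.length := List.length_pos_iff.2 hne.1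
    rw [stack, tableauInsert_cons, tableauInsert_cons, stack]
    rcases h : (rowInsert x s).2 with _ | y
    · obtain ⟨hsx, hs⟩ := rowInsert_of_not_bumped h
      rw [hs, rowInsert_append_drop hsx fun b hb =>
        hx.trans_le (hlt s.length b (by rwa [headD_getElem?] at hb)), headD_getElem?,
        List.length_append, List.length_singleton, List.append_assoc, List.singleton_append]
      congr 1
      -- The row of `S` has grown by one, so column `c = s.length` of `A` must no longer be raised
      -- below it. Either that column is empty, or its top `z` has been bumped and starts the chain.
      rcases hz : entry A 0 s.length with _ | z
      · rw [raiseFrom_succ_of_entry_eq_none hA hz]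
        rfl
      · exact tableauInsert_stack_raiseFrom hA hAm (fun t ht a ha => (hS.2 t ht a ha).le) hne.2 hd
          hlen.1 hz
    · rw [rowInsert_append_of_bumped h, length_rowInsert_of_bumped h]
      congr 1
      have hAm' : ∀ r ∈ raiseFrom s.length A, ∀ a ∈ r, m ≤ a := by
        intro t ht a ha
        obtain ⟨u, hu, hau⟩ := mem_of_mem_raiseFrom ht ha
        exact hAm u hu a hau
      refine ih (hA.raiseFrom hd) hAm' hS.2 hne.2 hlen.2 (hS.1 y (mem_of_bumped h)) ?_
      intro c b hb
      rw [entry_raiseFrom hA] at hb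
      split_ifs at hb with hc
      · exact hlt c b hb
      · obtain ⟨a, ha, hab⟩ := hA.lt 0 1 c b Nat.zero_lt_one hb
        exact (hlt c a ha).trans hab.le

theorem pairwise_length_insertionTableau (w : List ℕ) :
    (insertionTableau w).Pairwise fun s t => t.length ≤ s.length := by
  have := (sortedGE_insertionTableau w).pairwise
  rwa [List.pairwise_map] at this

theorem insertionTableau_append_of_lt {m : ℕ} {u v : List ℕ} (hu : ∀ a ∈ u, m ≤ a)
    (hv : ∀ a ∈ v, a < m) :
    insertionTableau (u ++ v) = stack (insertionTableau v) (insertionTableau u) := by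
  induction v using List.reverseRecOn with
  | nil => simp [insertionTableau, stack]
  | append_singleton v x ih =>
    rw [← List.append_assoc, insertionTableau_append_singleton,
      ih fun a ha => hv a (by simp [ha]), insertionTableau_append_singleton]
    exact tableauInsert_stack (isSemistandard_insertionTableau u)
      (fun r hr a ha => hu a (mem_of_mem_insertionTableau hr ha))
      (fun s hs a ha => hv a (by simp [mem_of_mem_insertionTableau hs ha]))
      (fun s hs => (forall_row_insertionTableau v s hs).2) (pairwise_length_insertionTableau v)
      (hv x (by simp))

/-! ### Column lengths -/

/-- The number of rows of length greater than `j`. -/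
def colLength (T : List (List ℕ)) (j : ℕ) : ℕ := T.countP fun r => j < r.length

theorem colLength_cons (r : List ℕ) (T : List (List ℕ)) (j : ℕ) :
    colLength (r :: T) j = colLength T j + if j < r.length then 1 else 0 := by
  simp [colLength, List.countP_cons]

theorem lt_colLength_iff {T : List (List ℕ)} (hT : T.Pairwise fun s t => t.length ≤ s.length)
    (i j : ℕ) : i < colLength T j ↔ j < (T.getD i []).length := by
  induction T generalizing i with
  | nil => simp [colLength]
  | cons r T ih =>
    rw [List.pairwise_cons] at hT
    rw [colLength_cons]
    by_cases hj : j < r.length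
    · cases i with
      | zero => simp [hj]
      | succ i => simpa [hj] using ih hT.2 i
    · have h0 : colLength T j = 0 := by
        rw [colLength, List.countP_eq_zero]
        intro t ht
        simpa using (hT.1 t ht).trans (not_lt.1 hj)
      have h2 : ((r :: T).getD i []).length ≤ j := by
        cases i with
        | zero => exact not_lt.1 hj
        | succ i => simpa [h0] using ih hT.2 i
      rw [h0, if_neg hj]
      omega

theorem IsSemistandard.pairwise_length {T : List (List ℕ)} (hT : IsSemistandard T) :
    T.Pairwise fun s t => t.length ≤ s.length := by
  refine List.isChain_iff_pairwise.1 (List.isChain_iff_getElem.2 fun i hi => ?_)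
  have := hT.length_le i
  rwa [List.getD_eq_getElem _ _ hi, List.getD_eq_getElem _ _ (Nat.lt_of_succ_lt hi)] at this

theorem lt_length_getD_iff (T : List (List ℕ)) (i j : ℕ) :
    j < (T.getD i []).length ↔ (entry T i j).isSome := by
  simp [entry]

theorem IsSemistandard.lt_colLength_iff {T : List (List ℕ)} (hT : IsSemistandard T) (i j : ℕ) :
    i < colLength T j ↔ (entry T i j).isSome := by
  rw [YoungClass.lt_colLength_iff hT.pairwise_length, lt_length_getD_iff]

theorem colLength_raiseFrom {T : List (List ℕ)} (hT : IsSemistandard T) {c : ℕ} (hc : 0 < c)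
    (j : ℕ) : colLength (raiseFrom c T) j =
      if j < c then colLength T j else colLength T j - 1 := by
  refine eq_of_forall_lt_iff fun i => ?_
  rw [(hT.raiseFrom hc).lt_colLength_iff, entry_raiseFrom hT]
  split_ifs with h
  · rw [hT.lt_colLength_iff]
  · rw [← hT.lt_colLength_iff]
    omega

/-- In a column `j < s.length` the row `s` adds one and `A` is not raised. In the other columns the
entry removed from `A` by raising reappears in the new row. -/
theorem colLength_stack {S A : List (List ℕ)} (hA : IsSemistandard A) (hne : ∀ s ∈ S, s ≠ [])
    (j : ℕ) : colLength (stack S A) j = colLength S j + colLength A j := by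
  induction S generalizing A with
  | nil => simp [stack, colLength]
  | cons s S ih =>
    rw [List.forall_mem_cons] at hne
    have hd : 0 < s.length := List.length_pos_iff.2 hne.1
    -- Decides whether the truncated subtraction in `colLength_raiseFrom` really removes an entry,
    -- which is exactly when the new row reaches column `j`.
    have h0 : 0 < colLength A j ↔ j < (A.headD []).length := by
      rw [YoungClass.lt_colLength_iff hA.pairwise_length]
      cases A <;> rfl
    have h1 := ih (hA.raiseFrom hd) hne.2
    rw [colLength_raiseFrom hA hd] at h1
    rw [stack, colLength_cons, colLength_cons, h1]
    simp only [List.length_append, List.length_drop]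
    split_ifs <;> omega

/-! ### Shapes of sums -/

/-- The sequence of values of a permutation. -/
def word {n : ℕ} (π : Equiv.Perm (Fin n)) : List ℕ := List.ofFn fun i => (π i : ℕ)

theorem lt_of_mem_word {n : ℕ} {π : Equiv.Perm (Fin n)} {a : ℕ} (h : a ∈ word π) : a < n := by
  obtain ⟨i, rfl⟩ := List.mem_ofFn.1 h
  exact (π i).isLt

theorem word_directSum {n k : ℕ} (α : Equiv.Perm (Fin n)) (β : Equiv.Perm (Fin k)) :
    word (directSum α β) = word α ++ (word β).map (n + ·) := by
  simp only [word, List.ofFn_add, List.map_ofFn]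
  congr 2 <;> funext i
  · exact directSum_castAdd α β i
  · exact directSum_natAdd α β i

theorem word_skewSum {n k : ℕ} (α : Equiv.Perm (Fin n)) (β : Equiv.Perm (Fin k)) :
    word (skewSum α β) = (word α).map (k + ·) ++ word β := by
  simp only [word, List.ofFn_add, List.map_ofFn]
  congr 2 <;> funext i
  · exact skewSum_castAdd α β i
  · exact skewSum_natAdd α β i

theorem mem_shape {n : ℕ} (π : Equiv.Perm (Fin n)) (i j : ℕ) :
    (i, j) ∈ shape π ↔ j < ((insertionTableau (word π)).getD i []).length := by
  rw [shape, YoungDiagram.mem_ofRowLens, ← word]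
  by_cases h : i < (insertionTableau (word π)).length
  · simp [h]
  · simp [h]

theorem rowLen_shape {n : ℕ} (π : Equiv.Perm (Fin n)) (i : ℕ) :
    (shape π).rowLen i = ((insertionTableau (word π)).getD i []).length :=
  eq_of_forall_lt_iff fun j => by rw [← YoungDiagram.mem_iff_lt_rowLen, mem_shape]

theorem colLen_shape {n : ℕ} (π : Equiv.Perm (Fin n)) (j : ℕ) :
    (shape π).colLen j = colLength (insertionTableau (word π)) j :=
  eq_of_forall_lt_iff fun i => by
    rw [← YoungDiagram.mem_iff_lt_colLen, mem_shape,
      lt_colLength_iff (pairwise_length_insertionTableau _)]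

theorem length_getD_map_map (f : ℕ → ℕ) (T : List (List ℕ)) (i : ℕ) :
    ((T.map (List.map f)).getD i []).length = (T.getD i []).length := by
  by_cases h : i < T.length <;> simp [h]

theorem colLength_map_map (f : ℕ → ℕ) (T : List (List ℕ)) (j : ℕ) :
    colLength (T.map (List.map f)) j = colLength T j := by
  simp [colLength, List.countP_map, Function.comp_def]

theorem shape_directSum {n k : ℕ} (α : Equiv.Perm (Fin n)) (β : Equiv.Perm (Fin k)) :
    shape (directSum α β) = partSum (shape α) (shape β) := by
  refine YoungDiagram.ext (Finset.ext fun ⟨i, j⟩ => ?_)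
  rw [YoungDiagram.mem_cells, YoungDiagram.mem_cells, YoungDiagram.mem_iff_lt_rowLen,
    YoungDiagram.mem_iff_lt_rowLen, rowLen_partSum, rowLen_shape, rowLen_shape, rowLen_shape,
    word_directSum, insertionTableau_append_of_le (fun a ha => (lt_of_mem_word ha).le)
      (by simp), length_getD_juxtapose, insertionTableau_map_add, length_getD_map_map]

theorem shape_skewSum {n k : ℕ} (α : Equiv.Perm (Fin n)) (β : Equiv.Perm (Fin k)) :
    shape (skewSum α β) = conjSum (shape α) (shape β) := by
  refine YoungDiagram.ext (Finset.ext fun ⟨i, j⟩ => ?_)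
  rw [YoungDiagram.mem_cells, YoungDiagram.mem_cells, YoungDiagram.mem_iff_lt_colLen,
    YoungDiagram.mem_iff_lt_colLen, conjSum, YoungDiagram.colLen_transpose, rowLen_partSum,
    YoungDiagram.rowLen_transpose, YoungDiagram.rowLen_transpose, colLen_shape, colLen_shape,
    colLen_shape, word_skewSum, insertionTableau_append_of_lt (m := k) (by simp)
      (fun a ha => lt_of_mem_word ha), colLength_stack (isSemistandard_insertionTableau _)
      (fun s hs => (forall_row_insertionTableau _ s hs).2), insertionTableau_map_add,
    colLength_map_map, Nat.add_comm]

end YoungClass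

theorem mainTheorem5 {n k : ℕ} (α : Equiv.Perm (Fin n)) (β : Equiv.Perm (Fin k)) :
    YoungClass.shape (YoungClass.directSum α β) =
        YoungClass.partSum (YoungClass.shape α) (YoungClass.shape β) ∧
      YoungClass.shape (YoungClass.skewSum α β) =
        YoungClass.conjSum (YoungClass.shape α) (YoungClass.shape β) :=
  ⟨YoungClass.shape_directSum α β, YoungClass.shape_skewSum α β⟩
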